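/- Let $\mathbb H$ be the quaternions, $d\mu_2(x)=\frac{dx}{2\pi}$ on $\mathbb R^2$, $d\mu_4=\frac{d(\xi,b)}{(2\pi)^2}$ on $\mathbb R^2\times\mathbb R^2=\mathbb R^4$, and let all $L^p$-spaces and norms $\|\cdot\|_p$ on $\mathbb R^2$ and $\mathbb R^4$ be taken with respect to $\mu_2$ and $\mu_4$. For $h\in L^1(\mathbb R^2,\mathbb H)$ let $$\mathcal F_Q(h)(u,v)=\int_{\mathbb R^2}e^{-ixu}\,h(x,y)\,e^{-jyv}\,d\mu_2(x,y)$$ be the two-sided quaternion Fourier transform. For $\xi=(\xi_1,\xi_2)\in\mathbb R^2$ let $A_\xi=\mathrm{diag}(\xi_1,\xi_2)$. A function $\varphi\in L^1(\mathbb R^2,\mathbb H)\cap L^2(\mathbb R^2,\mathbb H)$, $\varphi\neq0$, is called an admissible quaternion window if $$C_\varphi=\int_{\mathbb R^2}\bigl|\mathcal F_Q(\overline{\varphi})(1-\xi_1,1-\xi_2)\bigr|^2\,\frac{d\mu_2(\xi)}{|\det A_\xi|}$$ is finite and positive. The quaternion Stockwell transform of $f\in L^2(\mathbb R^2,\mathbb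 H)$ with respect to $\varphi$ is $$(S_\varphi^Qf)(\xi,b)=|\det A_\xi|^{1/2}\int_{\mathbb R^2}e^{-ix_1\xi_1}f(x)\,e^{-jx_2\xi_2}\,\overline{\varphi(A_\xi(x-b))}\,d\mu_2(x),\qquad \xi,b\in\mathbb R^2.$$ **Theorem (Lieb inequality).** Let $\varphi,\psi$ be admissible quaternion windows, each of which, written $h$, satisfies $$\mathcal F_Q(h)(u,v)\,e^{-jvy}=e^{-jvy}\,\mathcal F_Q(h)(u,v)\quad\text{and}\quad \mathcal F_Q(jh)(u,v)\,e^{-jvy}=j\,e^{-jvy}\,\mathcal F_Q(h)(u,v)\qquad\text{for all }u,v,y\in\mathbb R.$$ Let $p\in[1,\infty)$ and $f,g\in L^2(\mathbb R^2,\mathbb H)$. Then the function $(\xi,b)\mapsto (S_\varphi^Qf)(\xi,b)\,(S_\psi^Qg)(\xi,b)$ belongs to $L^p(\mathbb R^2\times\mathbb R^2,\mathbb H)$ and $$\bigl\|S_\varphi^Qf\cdot S_\psi^Qg\bigr\|_p\le\bigl(\sqrt{C_\varphi C_\psi}\bigr)^{1/p}\,\|f\|_2\,\|g\|_2\,\bigl(\|\varphi\|_2\|\psi\|_2\bigr)^{1-1/p}.$$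 -/

import Mathlib

open MeasureTheory
open scoped Quaternion ENNReal

namespace QStockwell

/-- The quaternion unit `i`. -/
def qi : ℍ[ℝ] := ⟨0, 1, 0, 0⟩

/-- The quaternion unit `j`. -/
def qj : ℍ[ℝ] := ⟨0, 0, 1, 0⟩

/-- `e^{i t}` in the quaternions. -/
noncomputable def expI (t : ℝ) : ℍ[ℝ] := NormedSpace.exp (t • qi)

/-- `e^{j t}` in the quaternions. -/
noncomputable def expJ (t : ℝ) : ℍ[ℝ] := NormedSpace.exp (t • qj)

/-- The normalized Lebesgue measure `dx / (2π)` on `ℝ²`. -/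
noncomputable def mu2 : Measure (ℝ × ℝ) := ENNReal.ofReal (1 / (2 * Real.pi)) • volume

/-- The normalized Lebesgue measure `dx / (2π)²` on `ℝ⁴ = ℝ² × ℝ²`. -/
noncomputable def mu4 : Measure ((ℝ × ℝ) × (ℝ × ℝ)) :=
  ENNReal.ofReal (1 / (2 * Real.pi) ^ 2) • volume

/-- The two-sided quaternion Fourier transform
`(u, v) ↦ ∫ e^{-i x u} f(x, y) e^{-j y v} dμ₂(x, y)` of an integrable function. -/
noncomputable def qFourier (f : ℝ × ℝ → ℍ[ℝ]) (w : ℝ × ℝ) : ℍ[ℝ] :=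
  ∫ x, expI (-(x.1 * w.1)) * f x * expJ (-(x.2 * w.2)) ∂mu2

/-- The commutation hypothesis on the quaternion Fourier transform of a window:
`F(g)(u,v) e^{-jvy} = e^{-jvy} F(g)(u,v)` and `F(jg)(u,v) e^{-jvy} = j e^{-jvy} F(g)(u,v)`. -/
def FourierCommutes (g : ℝ × ℝ → ℍ[ℝ]) : Prop :=
  (∀ u v y : ℝ, qFourier g (u, v) * expJ (-(v * y)) = expJ (-(v * y)) * qFourier g (u, v)) ∧
  (∀ u v y : ℝ, qFourier (fun x => qj * g x) (u, v) * expJ (-(v * y)) =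
    qj * expJ (-(v * y)) * qFourier g (u, v))

/-- The action of the diagonal matrix `A_ξ = diag(ξ₁, ξ₂)` on `ℝ²`. -/
def dil (ξ x : ℝ × ℝ) : ℝ × ℝ := (ξ.1 * x.1, ξ.2 * x.2)

/-- `det A_ξ` for the diagonal matrix `A_ξ = diag(ξ₁, ξ₂)`. -/
def detA (ξ : ℝ × ℝ) : ℝ := ξ.1 * ξ.2

/-- The integrand `|F(conj φ)(1 - ξ)|² / |det A_ξ|` of the admissibility constant, where `1`
is the vector `(1, 1)`. -/
noncomputable def admIntegrand (φ : ℝ × ℝ → ℍ[ℝ]) (ξ : ℝ × ℝ) : ℝ :=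
  ‖qFourier (fun x => star (φ x)) ((1, 1) - ξ)‖ ^ 2 / |detA ξ|

/-- The admissibility constant `C_φ`. -/
noncomputable def admConst (φ : ℝ × ℝ → ℍ[ℝ]) : ℝ := ∫ ξ, admIntegrand φ ξ ∂mu2

/-- Admissible quaternion windows: nonzero elements of `L¹ ∩ L²` for which the integral
defining `C_φ` is finite and positive. -/
structure IsAdmissibleWindow (φ : ℝ × ℝ → ℍ[ℝ]) : Prop where
  memL1 : MemLp φ 1 mu2
  memL2 : MemLp φ 2 mu2
  ne_zero : ¬ φ =ᵐ[mu2] 0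
  integrable : Integrable (admIntegrand φ) mu2
  pos : 0 < admConst φ

/-- The two-dimensional quaternion Stockwell transform of `f` with respect to the window `φ`,
as a function of `z = (ξ, b)`. -/
noncomputable def stockwell (φ f : ℝ × ℝ → ℍ[ℝ]) (z : (ℝ × ℝ) × (ℝ × ℝ)) : ℍ[ℝ] :=
  |detA z.1| ^ (1 / 2 : ℝ) •
    ∫ x, expI (-(x.1 * z.1.1)) * f x * expJ (-(x.2 * z.1.2)) * star (φ (dil z.1 (x - z.2))) ∂mu2

/-- The norm `(∫ |F|^p dμ)^{1/p}` of a quaternion-valued function, for `1 ≤ p < ∞`; it is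
applied only to functions in `L^p`. -/
noncomputable def qNorm {X : Type*} [MeasurableSpace X] (p : ℝ) (μ : Measure X)
    (F : X → ℍ[ℝ]) : ℝ :=
  (∫ x, ‖F x‖ ^ p ∂μ) ^ (1 / p)

end QStockwell

namespace QStockwell

/-! The inequality interpolates between two endpoints. Cauchy–Schwarz in the defining integral gives
`|S_φ f| ≤ ‖f‖₂ ‖φ‖₂` everywhere (`norm_stockwell_le`). The bound `‖S_φ f‖₂ ≤ √C_φ ‖f‖₂`
(`memLp_two_stockwell`) and Cauchy–Schwarz on `ℝ⁴` give the case `p = 1`. For general `p`, integrate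
`|AB|^p ≤ (sup |AB|)^(p-1) |AB|`.

The `L²` bound reduces to commutative Fourier analysis. Write `ℍ = (1 - k)(ℝ + ℝj) ⊕ (1 + k)(ℝ +
ℝj)`. On the summand `(1 - s k)(ℝ + ℝj)`, `s = ±1`, left multiplication by `i` is right
multiplication by `s j`, so the two-sided kernel becomes one complex character with first frequency
multiplied by `s` (`cpart_expI_mul`). Right multiplication by the window respects the splitting when
the window is `ℝ + ℝj`-valued. The commutation hypothesis forces this almost everywhere, and makes
the window's transform even in the first variable (`exists_complex_window`).

Each complex component is, in `b`, a convolution. Plancherel in `b`, Tonelli, and the invariance of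
`dξ / |det A_ξ|` under `ξ ↦ ξ⁻¹ w` give its orthogonality relation
(`lintegral_enorm_sq_cStockwell`); evenness makes the constants for `s = 1` and `s = -1` agree. -/

open FourierTransform SchwartzMap Filter


/-! ### Plancherel's theorem on `L¹ ∩ L²`. -/

section Plancherel

variable {E : Type*} [NormedAddCommGroup E] [InnerProductSpace ℝ E] [FiniteDimensional ℝ E]
  [MeasurableSpace E] [BorelSpace E]

/-- The `L²`-Fourier transform of a function in `L¹ ∩ L²` is given by the Fourier integral. -/
theorem coeFn_fourier_toLp {h : E → ℂ} (h1 : Integrable h) (h2 : MemLp h 2) :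
    ⇑(𝓕 (h2.toLp h) : Lp (α := E) ℂ 2) =ᵐ[volume] 𝓕 h := by
  have hcont : Continuous (𝓕 h) :=
    VectorFourier.fourierIntegral_continuous Real.continuous_fourierChar
      (by exact continuous_inner) h1
  -- Test both sides against smooth compactly supported functions. The `L²` transform is moved onto
  -- the test function through tempered distributions, the Fourier integral through the
  -- multiplication formula for integrable functions.
  refine ae_eq_of_integral_contDiff_smul_eq ((Lp.memLp _).locallyIntegrable (by norm_num))
    hcont.locallyIntegrable fun g hg hgc => ?_
  have hgc' : HasCompactSupport (fun x => (g x : ℂ)) :=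
    hgc.comp_left (g := fun r : ℝ => (r : ℂ)) (by simp)
  set G : 𝓢(E, ℂ) := hgc'.toSchwartzMap (Complex.ofRealCLM.contDiff.comp hg)
  have hG : ∀ x, G x = (g x : ℂ) := fun x => rfl
  have key := DFunLike.congr_fun (Lp.fourier_toTemperedDistribution_eq (h2.toLp h)) G
  rw [TemperedDistribution.fourier_apply, Lp.toTemperedDistribution_apply,
    Lp.toTemperedDistribution_apply] at key
  have e1 : ∫ x, (𝓕 G) x • (h2.toLp h) x = ∫ x, (𝓕 G) x • h x :=
    integral_congr_ae (by filter_upwards [h2.coeFn_toLp] with x hx; rw [hx])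
  have e2 : ∫ x, (𝓕 G) x • h x = ∫ x, G x • 𝓕 h x := by
    have := VectorFourier.integral_fourierIntegral_smul_eq_flip (μ := volume) (ν := volume)
      (L := innerₗ E) (f := G) (g := h) Real.continuous_fourierChar
      (by exact continuous_inner) G.integrable h1
    rw [flip_innerₗ] at this
    exact this
  simp only [hG] at key e2
  rw [e1, e2] at key
  simpa [Complex.real_smul] using key.symm

/-- Plancherel's theorem for the Fourier integral on `L¹ ∩ L²`. -/
theorem lintegral_enorm_sq_fourier {h : E → ℂ} (h1 : Integrable h) (h2 : MemLp h 2) :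
    ∫⁻ w, ‖𝓕 h w‖ₑ ^ 2 = ∫⁻ x, ‖h x‖ₑ ^ 2 := by
  have e : eLpNorm (𝓕 h) 2 volume = eLpNorm h 2 volume := by
    rw [← eLpNorm_congr_ae (coeFn_fourier_toLp h1 h2), ← eLpNorm_congr_ae h2.coeFn_toLp,
      ← Lp.enorm_def, ← Lp.enorm_def, ← ofReal_norm, ← ofReal_norm, Lp.norm_fourier_eq]
  rw [eLpNorm_eq_lintegral_rpow_enorm_toReal (by norm_num) (by norm_num),
    eLpNorm_eq_lintegral_rpow_enorm_toReal (by norm_num) (by norm_num)] at e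
  have := ENNReal.rpow_left_injective (x := 1 / (2 : ℝ≥0∞).toReal) (by norm_num) e
  simpa using this

end Plancherel

/-! ### Normalized measures and diagonal dilations. -/

instance : mu2.IsAddHaarMeasure :=
  Measure.IsAddHaarMeasure.smul _ (by simp [Real.pi_pos]) ENNReal.ofReal_ne_top

theorem mu4_eq_prod : mu4 = mu2.prod mu2 := by
  rw [mu4, mu2, Measure.prod_smul_left, Measure.prod_smul_right, smul_smul,
    ← ENNReal.ofReal_mul (by positivity)]
  congr 2
  field_simp

theorem ae_mu2_iff {p : ℝ × ℝ → Prop} : (∀ᵐ x ∂mu2, p x) ↔ ∀ᵐ x, p x := by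
  rw [mu2, Measure.ae_ennreal_smul_measure_iff (by simp [Real.pi_pos])]

theorem ae_detA_ne_zero : ∀ᵐ ξ ∂mu2, detA ξ ≠ 0 := by
  rw [ae_mu2_iff]
  have h1 : ∀ᵐ ξ : ℝ × ℝ, ξ.1 ≠ 0 :=
    Measure.quasiMeasurePreserving_fst.ae (p := fun t : ℝ => t ≠ 0) (Measure.ae_ne volume 0)
  have h2 : ∀ᵐ ξ : ℝ × ℝ, ξ.2 ≠ 0 :=
    Measure.quasiMeasurePreserving_snd.ae (p := fun t : ℝ => t ≠ 0) (Measure.ae_ne volume 0)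
  filter_upwards [h1, h2] with ξ a b using mul_ne_zero a b

theorem measurable_dil : Measurable fun p : (ℝ × ℝ) × (ℝ × ℝ) => dil p.1 p.2 := by
  unfold dil; fun_prop

theorem measurable_detA : Measurable detA := by
  unfold detA; fun_prop

theorem measurableEmbedding_dil {ξ : ℝ × ℝ} (hξ : detA ξ ≠ 0) : MeasurableEmbedding (dil ξ) :=
  (measurableEmbedding_mulLeft₀ (left_ne_zero_of_mul hξ)).prodMap
    (measurableEmbedding_mulLeft₀ (right_ne_zero_of_mul hξ))

theorem map_dil {ξ : ℝ × ℝ} (hξ : detA ξ ≠ 0) :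
    mu2.map (dil ξ) = ENNReal.ofReal |detA ξ|⁻¹ • mu2 := by
  have h : Measure.map (dil ξ) (volume : Measure (ℝ × ℝ)) =
      ENNReal.ofReal |detA ξ|⁻¹ • volume := by
    have : dil ξ = Prod.map (ξ.1 * ·) (ξ.2 * ·) := rfl
    rw [this, Measure.volume_eq_prod, ← Measure.map_prod_map _ _ (by fun_prop) (by fun_prop),
      Real.map_volume_mul_left (left_ne_zero_of_mul hξ),
      Real.map_volume_mul_left (right_ne_zero_of_mul hξ), Measure.prod_smul_left,
      Measure.prod_smul_right, smul_smul, ← ENNReal.ofReal_mul (by positivity), ← abs_mul,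
      detA, ← abs_inv, mul_inv]
  rw [mu2, Measure.map_smul, h, smul_comm]

theorem lintegral_comp_dil {ξ : ℝ × ℝ} (hξ : detA ξ ≠ 0) (G : ℝ × ℝ → ℝ≥0∞) :
    ∫⁻ x, G (dil ξ x) ∂mu2 = ENNReal.ofReal |detA ξ|⁻¹ * ∫⁻ x, G x ∂mu2 := by
  rw [← (measurableEmbedding_dil hξ).lintegral_map, map_dil hξ, lintegral_smul_measure, smul_eq_mul]

theorem integral_comp_dil {V : Type*} [NormedAddCommGroup V] [NormedSpace ℝ V]
    {ξ : ℝ × ℝ} (hξ : detA ξ ≠ 0) (G : ℝ × ℝ → V) :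
    ∫ x, G (dil ξ x) ∂mu2 = |detA ξ|⁻¹ • ∫ x, G x ∂mu2 := by
  rw [← (measurableEmbedding_dil hξ).integral_map, map_dil hξ, integral_smul_measure,
    ENNReal.toReal_ofReal (by positivity)]

theorem quasiMeasurePreserving_dil {ξ : ℝ × ℝ} (hξ : detA ξ ≠ 0) :
    Measure.QuasiMeasurePreserving (dil ξ) mu2 mu2 :=
  ⟨(measurableEmbedding_dil hξ).measurable, by
    rw [map_dil hξ]; exact Measure.smul_absolutelyContinuous⟩

theorem memLp_comp_dil {V : Type*} [NormedAddCommGroup V] {p : ℝ≥0∞}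
    {ξ : ℝ × ℝ} (hξ : detA ξ ≠ 0) {G : ℝ × ℝ → V} (hG : MemLp G p mu2) :
    MemLp (fun x => G (dil ξ x)) p mu2 := by
  have : MemLp G p (mu2.map (dil ξ)) := by
    rw [map_dil hξ]; exact hG.smul_measure ENNReal.ofReal_ne_top
  exact this.comp_of_map (measurableEmbedding_dil hξ).measurable.aemeasurable

/-! ### The complex Fourier transform on `ℝ²`. -/

/-- The bilinear form `x · w` on `ℝ²`. -/
def dot (x w : ℝ × ℝ) : ℝ := x.1 * w.1 + x.2 * w.2

/-- The character `t ↦ e^{-it}` with values in `ℂ`. -/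
noncomputable def chr (t : ℝ) : ℂ := Complex.exp (-(t * Complex.I))

theorem norm_chr (t : ℝ) : ‖chr t‖ = 1 := by
  rw [chr, ← neg_mul, ← Complex.ofReal_neg, Complex.norm_exp_ofReal_mul_I]

theorem chr_add (s t : ℝ) : chr (s + t) = chr s * chr t := by
  rw [chr, chr, chr, ← Complex.exp_add]; push_cast; ring_nf

theorem conj_chr (t : ℝ) : (starRingEnd ℂ) (chr t) = chr (-t) := by
  rw [chr, chr, ← Complex.exp_conj]; simp

theorem continuous_chr : Continuous chr := by unfold chr; fun_prop

theorem continuous_dot : Continuous fun p : (ℝ × ℝ) × (ℝ × ℝ) => dot p.1 p.2 := by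
  unfold dot; fun_prop

theorem memLp_chr_mul {p : ℝ≥0∞} {F : ℝ × ℝ → ℂ} (hF : MemLp F p mu2) (w : ℝ × ℝ) :
    MemLp (fun x => chr (dot x w) * F x) p mu2 := by
  refine hF.of_le ?_ (.of_forall fun x => by rw [norm_mul, norm_chr, one_mul])
  exact (continuous_chr.comp (continuous_dot.comp
    (by fun_prop : Continuous fun x : ℝ × ℝ => (x, w)))).aestronglyMeasurable.mul hF.1

/-- The Fourier transform of complex functions on `ℝ²` in the normalization of `μ₂`. -/
noncomputable def cFourier (F : ℝ × ℝ → ℂ) (w : ℝ × ℝ) : ℂ := ∫ x, chr (dot x w) * F x ∂mu2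

theorem cFourier_congr {F G : ℝ × ℝ → ℂ} (h : F =ᵐ[mu2] G) : cFourier F = cFourier G := by
  ext w
  exact integral_congr_ae (by filter_upwards [h] with x hx; rw [hx])

/-- `𝓕` has kernel `e^{-2πi⟨x, w⟩}`, whence the frequency scaling by `(2π)⁻¹`; it needs an inner
product space, whence `WithLp 2` in place of the sup-normed product. -/
theorem cFourier_eq_fourier (F : ℝ × ℝ → ℂ) (w : ℝ × ℝ) :
    cFourier F w = (2 * Real.pi)⁻¹ •
      𝓕 (fun x : WithLp 2 (ℝ × ℝ) => F x.ofLp)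
        (WithLp.toLp 2 (dil ((2 * Real.pi)⁻¹, (2 * Real.pi)⁻¹) w)) := by
  rw [cFourier, mu2, integral_smul_measure, ENNReal.toReal_ofReal (by positivity), one_div,
    Real.fourier_eq', ← (WithLp.volume_preserving_toLp ℝ ℝ).integral_comp
      (MeasurableEquiv.toLp 2 (ℝ × ℝ)).measurableEmbedding]
  congr 2
  ext x
  rw [smul_eq_mul, chr]
  congr 2
  simp only [WithLp.prod_inner_apply, dot, dil]
  simp
  field_simp

/-- Plancherel's theorem in the normalization of `μ₂`. -/
theorem lintegral_enorm_sq_cFourier {F : ℝ × ℝ → ℂ} (h1 : MemLp F 1 mu2) (h2 : MemLp F 2 mu2) :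
    ∫⁻ w, ‖cFourier F w‖ₑ ^ 2 ∂mu2 = ∫⁻ x, ‖F x‖ₑ ^ 2 ∂mu2 := by
  have hc : ENNReal.ofReal (1 / (2 * Real.pi)) ≠ 0 := by simp [Real.pi_pos]
  have hv {p : ℝ≥0∞} (h : MemLp F p mu2) : MemLp F p (volume : Measure (ℝ × ℝ)) := by
    have := h.smul_measure (c := (ENNReal.ofReal (1 / (2 * Real.pi)))⁻¹) (by simp [Real.pi_pos])
    rwa [mu2, smul_smul, ENNReal.inv_mul_cancel hc ENNReal.ofReal_ne_top, one_smul] at this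
  have hofLp := WithLp.volume_preserving_ofLp ℝ ℝ
  have htoLp := WithLp.volume_preserving_toLp ℝ ℝ
  have P := lintegral_enorm_sq_fourier (E := WithLp 2 (ℝ × ℝ))
    (h := fun x => F x.ofLp)
    (memLp_one_iff_integrable.1 ((hv h1).comp_measurePreserving hofLp))
    ((hv h2).comp_measurePreserving hofLp)
  rw [hofLp.lintegral_comp_emb (MeasurableEquiv.toLp 2 (ℝ × ℝ)).symm.measurableEmbedding
      (fun x => ‖F x‖ₑ ^ 2),
    ← htoLp.lintegral_comp_emb (MeasurableEquiv.toLp 2 (ℝ × ℝ)).measurableEmbedding] at P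
  have hd : detA ((2 * Real.pi)⁻¹, (2 * Real.pi)⁻¹) ≠ 0 := by simp [detA, Real.pi_ne_zero]
  simp_rw [cFourier_eq_fourier, enorm_smul, mul_pow]
  rw [lintegral_const_mul' _ _ (ENNReal.pow_ne_top enorm_ne_top), lintegral_comp_dil hd
    (fun y => ‖𝓕 (fun x : WithLp 2 (ℝ × ℝ) => F x.ofLp) (WithLp.toLp 2 y)‖ₑ ^ 2), ← mul_assoc]
  -- The squared normalization `(2π)⁻²` cancels the Jacobian `(2π)²` of the frequency scaling.
  have e : ‖(2 * Real.pi)⁻¹‖ₑ ^ 2 *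
      ENNReal.ofReal |detA ((2 * Real.pi)⁻¹, (2 * Real.pi)⁻¹)|⁻¹ = 1 := by
    rw [Real.enorm_eq_ofReal (by positivity), ← ENNReal.ofReal_pow (by positivity),
      ← ENNReal.ofReal_mul (by positivity), detA, abs_of_pos (by positivity)]
    rw [← ENNReal.ofReal_one]; congr 1; field_simp
  rw [e, one_mul, mu2, lintegral_smul_measure, lintegral_smul_measure, P]

theorem cFourier_chr_mul (F : ℝ × ℝ → ℂ) (m w : ℝ × ℝ) :
    cFourier (fun x => chr (dot x m) * F x) w = cFourier F (w + m) := by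
  unfold cFourier
  congr 1; ext x
  rw [← mul_assoc, ← chr_add]
  congr 2; simp only [dot, Prod.fst_add, Prod.snd_add]; ring

/-! ### Convolutions in `L¹ ∩ L²`. -/

section Convolution

variable {G H : ℝ × ℝ → ℂ}

theorem integrable_conv (hG : MemLp G 1 mu2) (hH : MemLp H 1 mu2) :
    Integrable (fun b => ∫ x, G x * H (b - x) ∂mu2) mu2 :=
  (memLp_one_iff_integrable.1 hG).integrable_convolution (ContinuousLinearMap.mul ℝ ℂ)
    (memLp_one_iff_integrable.1 hH)

theorem norm_integral_mul_le {X A : Type*} [MeasurableSpace X] {μ : Measure X}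
    [NormedRing A] [NormedSpace ℝ A]
    {f g : X → A} (hf : MemLp f 2 μ) (hg : MemLp g 2 μ) :
    ∫ x, ‖f x‖ * ‖g x‖ ∂μ ≤
      (∫ x, ‖f x‖ ^ (2 : ℝ) ∂μ) ^ (1 / 2 : ℝ) * (∫ x, ‖g x‖ ^ (2 : ℝ) ∂μ) ^ (1 / 2 : ℝ) :=
  integral_mul_norm_le_Lp_mul_Lq Real.HolderConjugate.two_two (by simpa using hf)
    (by simpa using hg)

/-- The convolution is integrable and, by Cauchy–Schwarz, bounded by some `M`; hence its square is
at most `M` times an integrable function. -/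
theorem memLp_two_conv (hG : MemLp G 1 mu2) (hH : MemLp H 1 mu2) (hG2 : MemLp G 2 mu2)
    (hH2 : MemLp H 2 mu2) : MemLp (fun b => ∫ x, G x * H (b - x) ∂mu2) 2 mu2 := by
  have hI := integrable_conv hG hH
  rw [memLp_two_iff_integrable_sq_norm hI.aestronglyMeasurable]
  set M := (∫ x, ‖G x‖ ^ (2 : ℝ) ∂mu2) ^ (1 / 2 : ℝ) * (∫ x, ‖H x‖ ^ (2 : ℝ) ∂mu2) ^ (1 / 2 : ℝ)
  have hb : ∀ b, ‖∫ x, G x * H (b - x) ∂mu2‖ ≤ M := fun b => by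
    have hHb : MemLp (fun x => H (b - x)) 2 mu2 :=
      hH2.comp_measurePreserving (Measure.measurePreserving_sub_left mu2 b)
    refine (norm_integral_le_integral_norm _).trans ?_
    simp_rw [norm_mul]
    refine (norm_integral_mul_le hG2 hHb).trans_eq ?_
    rw [integral_sub_left_eq_self (fun x => ‖H x‖ ^ (2 : ℝ)) mu2 b]
  simp_rw [sq]
  exact hI.norm.bdd_mul (c := M) hI.norm.aestronglyMeasurable (.of_forall fun b => by
    simpa using hb b)

theorem cFourier_conv (hG : MemLp G 1 mu2) (hH : MemLp H 1 mu2) (w : ℝ × ℝ) :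
    cFourier (fun b => ∫ x, G x * H (b - x) ∂mu2) w = cFourier G w * cFourier H w := by
  have := integral_convolution (μ := mu2) (ν := mu2) (ContinuousLinearMap.mul ℝ ℂ)
    (memLp_one_iff_integrable.1 (memLp_chr_mul hG w))
    (memLp_one_iff_integrable.1 (memLp_chr_mul hH w))
  simp only [ContinuousLinearMap.mul_apply'] at this
  rw [cFourier, cFourier, cFourier, ← this]
  congr 1; ext b
  rw [← integral_const_mul, convolution_def]
  congr 1; ext x
  have : chr (dot b w) = chr (dot x w) * chr (dot (b - x) w) := by
    rw [← chr_add]; congr 1; simp only [dot, Prod.fst_sub, Prod.snd_sub]; ring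
  rw [this, ContinuousLinearMap.mul_apply']; ring

theorem lintegral_enorm_sq_conv (hG : MemLp G 1 mu2) (hH : MemLp H 1 mu2) (hG2 : MemLp G 2 mu2)
    (hH2 : MemLp H 2 mu2) :
    ∫⁻ b, ‖∫ x, G x * H (b - x) ∂mu2‖ₑ ^ 2 ∂mu2 =
      ∫⁻ w, ‖cFourier G w‖ₑ ^ 2 * ‖cFourier H w‖ₑ ^ 2 ∂mu2 := by
  rw [← lintegral_enorm_sq_cFourier (memLp_one_iff_integrable.2 (integrable_conv hG hH))
    (memLp_two_conv hG hH hG2 hH2)]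
  simp_rw [cFourier_conv hG hH, enorm_mul, mul_pow]

end Convolution

/-! ### Quaternion exponentials and the splitting of `ℍ` into two complex lines. -/

@[simp] theorem qi_re : (qi).re = 0 := rfl
@[simp] theorem qi_imI : (qi).imI = 1 := rfl
@[simp] theorem qi_imJ : (qi).imJ = 0 := rfl
@[simp] theorem qi_imK : (qi).imK = 0 := rfl

@[simp] theorem qj_re : (qj).re = 0 := rfl
@[simp] theorem qj_imI : (qj).imI = 0 := rfl
@[simp] theorem qj_imJ : (qj).imJ = 1 := rfl
@[simp] theorem qj_imK : (qj).imK = 0 := rfl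

theorem expI_eq (t : ℝ) : expI t = ⟨Real.cos t, Real.sin t, 0, 0⟩ := by
  have hn : ‖t • qi‖ = |t| := by
    have : ‖qi‖ = 1 := by
      rw [← sq_eq_sq₀ (norm_nonneg _) zero_le_one, sq, ← Quaternion.normSq_eq_norm_mul_self,
        Quaternion.normSq_def']
      simp
    rw [norm_smul, this, mul_one, Real.norm_eq_abs]
  rw [expI, Quaternion.exp_of_re_eq_zero _ (by simp), hn]
  rcases eq_or_ne t 0 with rfl | ht
  · ext <;> simp
  · rcases abs_choice t with h | h <;> rw [h] <;> ext <;> simp <;> field_simp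

theorem expJ_eq (t : ℝ) : expJ t = ⟨Real.cos t, 0, Real.sin t, 0⟩ := by
  have hn : ‖t • qj‖ = |t| := by
    have : ‖qj‖ = 1 := by
      rw [← sq_eq_sq₀ (norm_nonneg _) zero_le_one, sq, ← Quaternion.normSq_eq_norm_mul_self,
        Quaternion.normSq_def']
      simp
    rw [norm_smul, this, mul_one, Real.norm_eq_abs]
  rw [expJ, Quaternion.exp_of_re_eq_zero _ (by simp), hn]
  rcases eq_or_ne t 0 with rfl | ht
  · ext <;> simp
  · rcases abs_choice t with h | h <;> rw [h] <;> ext <;> simp <;> field_simp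

@[simp] theorem expI_re (t : ℝ) : (expI t).re = Real.cos t := by rw [expI_eq]
@[simp] theorem expI_imI (t : ℝ) : (expI t).imI = Real.sin t := by rw [expI_eq]
@[simp] theorem expI_imJ (t : ℝ) : (expI t).imJ = 0 := by rw [expI_eq]
@[simp] theorem expI_imK (t : ℝ) : (expI t).imK = 0 := by rw [expI_eq]

@[simp] theorem expJ_re (t : ℝ) : (expJ t).re = Real.cos t := by rw [expJ_eq]
@[simp] theorem expJ_imI (t : ℝ) : (expJ t).imI = 0 := by rw [expJ_eq]
@[simp] theorem expJ_imJ (t : ℝ) : (expJ t).imJ = Real.sin t := by rw [expJ_eq]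
@[simp] theorem expJ_imK (t : ℝ) : (expJ t).imK = 0 := by rw [expJ_eq]

theorem quaternion_norm_sq (q : ℍ[ℝ]) :
    ‖q‖ ^ 2 = q.re ^ 2 + q.imI ^ 2 + q.imJ ^ 2 + q.imK ^ 2 := by
  rw [sq, ← Quaternion.normSq_eq_norm_mul_self, Quaternion.normSq_def']

theorem norm_expI (t : ℝ) : ‖expI t‖ = 1 := by
  rw [← sq_eq_sq₀ (norm_nonneg _) zero_le_one, quaternion_norm_sq]
  simp

theorem norm_expJ (t : ℝ) : ‖expJ t‖ = 1 := by
  rw [← sq_eq_sq₀ (norm_nonneg _) zero_le_one, quaternion_norm_sq]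
  simp

theorem continuous_expI : Continuous expI := by
  let _ : NormedAlgebra ℚ ℍ[ℝ] := NormedAlgebra.restrictScalars ℚ ℝ ℍ[ℝ]
  exact (NormedSpace.exp_continuous (𝔸 := ℍ[ℝ])).comp (by fun_prop)

theorem continuous_expJ : Continuous expJ := by
  let _ : NormedAlgebra ℚ ℍ[ℝ] := NormedAlgebra.restrictScalars ℚ ℝ ℍ[ℝ]
  exact (NormedSpace.exp_continuous (𝔸 := ℍ[ℝ])).comp (by fun_prop)

/-- The embedding of `ℂ` as the subfield `ℝ + ℝ j` of the quaternions. -/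
def ofCj (w : ℂ) : ℍ[ℝ] := ⟨w.re, 0, w.im, 0⟩

@[simp] theorem ofCj_re (w : ℂ) : (ofCj w).re = w.re := rfl
@[simp] theorem ofCj_imI (w : ℂ) : (ofCj w).imI = 0 := rfl
@[simp] theorem ofCj_imJ (w : ℂ) : (ofCj w).imJ = w.im := rfl
@[simp] theorem ofCj_imK (w : ℂ) : (ofCj w).imK = 0 := rfl

theorem star_ofCj (w : ℂ) : star (ofCj w) = ofCj ((starRingEnd ℂ) w) := by
  ext <;> simp

theorem norm_ofCj (w : ℂ) : ‖ofCj w‖ = ‖w‖ := by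
  rw [← sq_eq_sq₀ (norm_nonneg _) (norm_nonneg _), quaternion_norm_sq, Complex.sq_norm,
    Complex.normSq_apply]
  simp [sq]

/-- For `s = 1` and `s = -1`, the coordinate of a quaternion in `(1 - k) (ℝ + ℝ j)` and
`(1 + k) (ℝ + ℝ j)`. -/
noncomputable def cpart (s : ℝ) : ℍ[ℝ] →L[ℝ] ℂ :=
  LinearMap.toContinuousLinearMap
    { toFun := fun q => ⟨(q.re - s * q.imK) / 2, (q.imJ + s * q.imI) / 2⟩
      map_add' := fun q r => by
        apply Complex.ext <;> simp <;> ring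
      map_smul' := fun a q => by
        apply Complex.ext <;> simp <;> ring }

theorem cpart_apply (s : ℝ) (q : ℍ[ℝ]) :
    cpart s q = ⟨(q.re - s * q.imK) / 2, (q.imJ + s * q.imI) / 2⟩ := rfl

/-- The two summands are orthogonal and `|1 ∓ k|² = 2`. -/
theorem norm_sq_eq_cpart (q : ℍ[ℝ]) : ‖q‖ ^ 2 = 2 * (‖cpart 1 q‖ ^ 2 + ‖cpart (-1) q‖ ^ 2) := by
  rw [quaternion_norm_sq, Complex.sq_norm, Complex.sq_norm, Complex.normSq_apply,
    Complex.normSq_apply, cpart_apply, cpart_apply]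
  simp only
  ring

theorem cpart_mul_ofCj (s : ℝ) (q : ℍ[ℝ]) (w : ℂ) :
    cpart s (q * ofCj w) = cpart s q * w := by
  rw [cpart_apply, cpart_apply]
  apply Complex.ext <;> simp <;> ring

theorem cpart_ofCj (s : ℝ) (w : ℂ) : cpart s (ofCj w) = w / 2 := by
  rw [cpart_apply]
  apply Complex.ext <;> simp

theorem chr_re (t : ℝ) : (chr t).re = Real.cos t := by
  rw [chr, ← neg_mul, ← Complex.ofReal_neg, Complex.exp_ofReal_mul_I_re, Real.cos_neg]

theorem chr_im (t : ℝ) : (chr t).im = -Real.sin t := by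
  rw [chr, ← neg_mul, ← Complex.ofReal_neg, Complex.exp_ofReal_mul_I_im, Real.sin_neg]

/-- Since `i (1 - s k) = s (1 - s k) j`, the left factor `e^{-ia}` acts as the right factor
`e^{-jsa}` and merges with `e^{-jb}`. -/
theorem cpart_expI_mul {s : ℝ} (hs : s = 1 ∨ s = -1) (a b : ℝ) (q : ℍ[ℝ]) :
    cpart s (expI (-a) * q * expJ (-b)) = chr (s * a + b) * cpart s q := by
  rw [chr_add, cpart_apply, cpart_apply]
  rcases hs with rfl | rfl <;> apply Complex.ext <;> simp [chr_re, chr_im] <;> ring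

theorem norm_expI_mul_expJ (a b : ℝ) (q : ℍ[ℝ]) : ‖expI a * q * expJ b‖ = ‖q‖ := by
  rw [norm_mul, norm_mul, norm_expI, norm_expJ, one_mul, mul_one]

theorem memLp_expI_mul_expJ {p : ℝ≥0∞} {f : ℝ × ℝ → ℍ[ℝ]} (hf : MemLp f p mu2) (w : ℝ × ℝ) :
    MemLp (fun x => expI (-(x.1 * w.1)) * f x * expJ (-(x.2 * w.2))) p mu2 := by
  refine hf.of_le ?_ (.of_forall fun x => (norm_expI_mul_expJ _ _ _).le)
  have h1 : Continuous fun x : ℝ × ℝ => expI (-(x.1 * w.1)) := continuous_expI.comp (by fun_prop)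
  have h2 : Continuous fun x : ℝ × ℝ => expJ (-(x.2 * w.2)) := continuous_expJ.comp (by fun_prop)
  exact (h1.aestronglyMeasurable.mul hf.1).mul h2.aestronglyMeasurable

/-! ### The quaternion Fourier transform and the commutation hypothesis. -/

theorem cpart_qFourier {s : ℝ} (hs : s = 1 ∨ s = -1) {h : ℝ × ℝ → ℍ[ℝ]} (hh : MemLp h 1 mu2)
    (u v : ℝ) : cpart s (qFourier h (u, v)) = cFourier (fun x => cpart s (h x)) (s * u, v) := by
  rw [qFourier, ← ContinuousLinearMap.integral_comp_comm _
    (memLp_one_iff_integrable.1 (memLp_expI_mul_expJ hh (u, v))), cFourier]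
  congr 1; ext x
  rw [cpart_expI_mul hs]
  congr 2; simp only [dot]; ring

/-- `i` and `j` anticommute, so moving `j` to the left through `e^{-ixu}` reverses the sign of `u`.
-/
theorem qFourier_qj_mul {h : ℝ × ℝ → ℍ[ℝ]} (hh : MemLp h 1 mu2) (u v : ℝ) :
    qFourier (fun x => qj * h x) (u, v) = qj * qFourier h (-u, v) := by
  rw [qFourier, qFourier, ← integral_const_mul_of_integrable
    (memLp_one_iff_integrable.1 (memLp_expI_mul_expJ hh (-u, v)))]
  congr 1; ext1 x
  have : expI (-(x.1 * u)) * qj = qj * expI (-(x.1 * -u)) := by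
    ext <;> simp
  simp only [← mul_assoc, this]

/-- At `y = 0` the second commutation relation says that `j` passes through the transform unchanged;
compare with `qFourier_qj_mul` and cancel `j`. -/
theorem qFourier_neg_of_fourierCommutes {φ : ℝ × ℝ → ℍ[ℝ]} (hφ : MemLp φ 1 mu2)
    (hF : FourierCommutes φ) (u v : ℝ) : qFourier φ (-u, v) = qFourier φ (u, v) := by
  have h := hF.2 u v 0
  have h0 : expJ (-(v * 0)) = 1 := by simp [expJ]
  rw [h0, mul_one, mul_one, qFourier_qj_mul hφ] at h
  refine mul_left_cancel₀ (fun h0 => ?_) h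
  simpa using congrArg (fun q : ℍ[ℝ] => q.imJ) h0

theorem cpart_qFourier_eq_of_fourierCommutes {φ : ℝ × ℝ → ℍ[ℝ]}
    (hF : FourierCommutes φ) (u : ℝ) {v : ℝ} (hv : v ≠ 0) :
    cpart 1 (qFourier φ (u, v)) = cpart (-1) (qFourier φ (u, v)) := by
  -- This `y` makes `e^{-jvy} = j`. Commuting with `j` kills the `i` and `k` components, which are
  -- all that distinguishes the two parts.
  have h := hF.1 u v (-(Real.pi / 2) / v)
  have h0 : expJ (-(v * (-(Real.pi / 2) / v))) = qj := by
    rw [mul_div_cancel₀ _ hv, neg_neg, expJ_eq, Real.cos_pi_div_two, Real.sin_pi_div_two]; rfl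
  rw [h0] at h
  have h1 := congrArg (fun q : ℍ[ℝ] => q.imI) h
  have h2 := congrArg (fun q : ℍ[ℝ] => q.imK) h
  simp at h1 h2
  rw [cpart_apply, cpart_apply]
  apply Complex.ext <;> simp only <;> linarith

theorem cFourier_sub {F G : ℝ × ℝ → ℂ} (hF : MemLp F 1 mu2) (hG : MemLp G 1 mu2) (w : ℝ × ℝ) :
    cFourier (fun x => F x - G x) w = cFourier F w - cFourier G w := by
  rw [cFourier, cFourier, cFourier, ← integral_sub
    (memLp_one_iff_integrable.1 (memLp_chr_mul hF w))
    (memLp_one_iff_integrable.1 (memLp_chr_mul hG w))]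
  simp_rw [mul_sub]

theorem ae_eq_zero_of_cFourier {F : ℝ × ℝ → ℂ} (h1 : MemLp F 1 mu2) (h2 : MemLp F 2 mu2)
    (h : ∀ᵐ w ∂mu2, cFourier F w = 0) : F =ᵐ[mu2] 0 := by
  have P := lintegral_enorm_sq_cFourier h1 h2
  rw [lintegral_congr_ae (g := fun _ => 0) (by filter_upwards [h] with w hw; simp [hw]),
    lintegral_zero, eq_comm, lintegral_eq_zero_iff' (h1.1.enorm.pow_const 2)] at P
  filter_upwards [P] with x hx
  simpa using hx

/-- A window satisfying the commutation hypothesis takes its values in `ℝ + ℝ j`, and its Fourier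
transform is even in the first variable. -/
theorem exists_complex_window {φ : ℝ × ℝ → ℍ[ℝ]} (hφ1 : MemLp φ 1 mu2) (hφ2 : MemLp φ 2 mu2)
    (hF : FourierCommutes φ) :
    ∃ c : ℝ × ℝ → ℂ, StronglyMeasurable c ∧ MemLp c 1 mu2 ∧ MemLp c 2 mu2 ∧
      (φ =ᵐ[mu2] fun x => ofCj (c x)) ∧ ∀ u v, cFourier c (-u, v) = cFourier c (u, v) := by
  have hP {p : ℝ≥0∞} (hp : MemLp φ p mu2) (s : ℝ) : MemLp (fun x => cpart s (φ x)) p mu2 :=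
    (cpart s).comp_memLp' hp
  have hzero : ∀ᵐ x ∂mu2, cpart 1 (φ x) - cpart (-1) (φ x) = 0 := by
    refine ae_eq_zero_of_cFourier ((hP hφ1 1).sub (hP hφ1 (-1))) ((hP hφ2 1).sub (hP hφ2 (-1))) ?_
    filter_upwards [ae_detA_ne_zero] with w hw
    obtain ⟨u, v⟩ := w
    have hv : v ≠ 0 := right_ne_zero_of_mul hw
    rw [cFourier_sub (hP hφ1 1) (hP hφ1 (-1))]
    have e1 := cpart_qFourier (s := 1) (.inl rfl) hφ1 u v
    -- For `s = -1` the first frequency is reversed, so evaluating at `-u` brings both parts to the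
    -- same frequency; evenness then removes the sign.
    have e2 := cpart_qFourier (s := -1) (.inr rfl) hφ1 (-u) v
    rw [qFourier_neg_of_fourierCommutes hφ1 hF] at e2
    rw [one_mul] at e1
    rw [neg_one_mul, neg_neg] at e2
    rw [← e1, ← e2, cpart_qFourier_eq_of_fourierCommutes hF u hv, sub_self]
  -- The factor `2` inverts `cpart_ofCj`. A strongly measurable representative is taken below, for
  -- the joint measurability that Tonelli requires.
  set c₀ : ℝ × ℝ → ℂ := fun x => (2 : ℂ) * cpart 1 (φ x) with hc₀
  have h1 : MemLp c₀ 1 mu2 := (hP hφ1 1).const_mul 2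
  have h2 : MemLp c₀ 2 mu2 := (hP hφ2 1).const_mul 2
  have hae : c₀ =ᵐ[mu2] h1.1.mk c₀ := h1.1.ae_eq_mk
  refine ⟨h1.1.mk c₀, h1.1.stronglyMeasurable_mk, (memLp_congr_ae hae).1 h1,
    (memLp_congr_ae hae).1 h2, ?_, fun u v => ?_⟩
  · filter_upwards [hae, hzero] with x hx h0
    rw [← hx, hc₀]
    have hr := congrArg Complex.re h0
    have hi := congrArg Complex.im h0
    simp [cpart_apply] at hr hi
    ext <;> simp [cpart_apply] <;> linarith
  · rw [← cFourier_congr hae]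
    have e (u v : ℝ) : cFourier c₀ (u, v) = 2 * cpart 1 (qFourier φ (u, v)) := by
      rw [cpart_qFourier (.inl rfl) hφ1, cFourier, cFourier, ← integral_const_mul, one_mul]
      congr 1; ext x; rw [hc₀]; ring
    rw [e, e, qFourier_neg_of_fourierCommutes hφ1 hF]

theorem cFourier_conj (c : ℝ × ℝ → ℂ) (w : ℝ × ℝ) :
    cFourier (fun x => (starRingEnd ℂ) (c x)) w = (starRingEnd ℂ) (cFourier c (-w)) := by
  rw [cFourier, cFourier, ← integral_conj]
  congr 1; ext x
  rw [map_mul, conj_chr]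
  congr 2; simp only [dot, Prod.fst_neg, Prod.snd_neg]; ring

/-- Both parts of the conjugate window equal `conj c / 2`, and by evenness their transforms at the
frequencies `(±u, v)` have equal modulus; the weights add up to `2 (1/4 + 1/4) = 1`. -/
theorem norm_sq_qFourier_star {φ : ℝ × ℝ → ℍ[ℝ]} {c : ℝ × ℝ → ℂ} (hφ : MemLp φ 1 mu2)
    (hc : φ =ᵐ[mu2] fun x => ofCj (c x)) (he : ∀ u v, cFourier c (-u, v) = cFourier c (u, v))
    (w : ℝ × ℝ) :
    ‖qFourier (fun x => star (φ x)) w‖ ^ 2 = ‖cFourier c (-w)‖ ^ 2 := by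
  obtain ⟨u, v⟩ := w
  have hs : MemLp (fun x => star (φ x)) 1 mu2 :=
    hφ.of_le (continuous_star.comp_aestronglyMeasurable hφ.1)
      (.of_forall fun x => (norm_star _).le)
  have key (s : ℝ) (w : ℝ × ℝ) : cFourier (fun x => cpart s (star (φ x))) w =
      (starRingEnd ℂ) (cFourier c (-w)) / 2 := by
    rw [← cFourier_conj, cFourier, cFourier, ← integral_div]
    refine integral_congr_ae ?_
    filter_upwards [hc] with x hx
    rw [hx, star_ofCj, cpart_ofCj, mul_div_assoc]
  rw [norm_sq_eq_cpart, cpart_qFourier (.inl rfl) hs, cpart_qFourier (.inr rfl) hs, key, key,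
    norm_div, norm_div, RCLike.norm_conj, RCLike.norm_conj]
  simp only [Prod.neg_mk, one_mul, neg_one_mul, neg_neg]
  rw [he u (-v), div_pow]
  norm_num
  ring

/-! ### The complex Stockwell transforms and their orthogonality relation. -/

theorem continuous_cFourier {F : ℝ × ℝ → ℂ} (hF : MemLp F 1 mu2) : Continuous (cFourier F) := by
  refine continuous_of_dominated (bound := fun x => ‖F x‖) (fun w => (memLp_chr_mul hF w).1)
    (fun w => .of_forall fun x => by rw [norm_mul, norm_chr, one_mul])
    (memLp_one_iff_integrable.1 hF).norm (.of_forall fun x => ?_)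
  exact (continuous_chr.comp (continuous_dot.comp
    (by fun_prop : Continuous fun w : ℝ × ℝ => (x, w)))).mul continuous_const

/-- The measure `dx / |x|` is invariant under the involution `x ↦ w / x` of the nonzero reals. -/
theorem lintegral_inv_mul_comp_div {w : ℝ} (hw : w ≠ 0) (g : ℝ → ℝ≥0∞) :
    ∫⁻ x, ENNReal.ofReal |x|⁻¹ * g (x⁻¹ * w) = ∫⁻ x, ENNReal.ofReal |x|⁻¹ * g x := by
  have himg : (fun x : ℝ => x⁻¹ * w) '' {0}ᶜ = {0}ᶜ := by
    ext y
    constructor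
    · rintro ⟨x, hx, rfl⟩
      exact mul_ne_zero (inv_ne_zero hx) hw
    · intro hy
      have hy' : y ≠ 0 := hy
      exact ⟨w / y, div_ne_zero hw hy', by simp only; field_simp⟩
  have hinj : Set.InjOn (fun x : ℝ => x⁻¹ * w) {0}ᶜ := fun x _ y _ h =>
    inv_injective (mul_right_cancel₀ hw h)
  have hd : ∀ x ∈ ({0}ᶜ : Set ℝ),
      HasDerivWithinAt (fun x : ℝ => x⁻¹ * w) (-(x ^ 2)⁻¹ * w) {0}ᶜ x := fun x hx =>
    ((hasDerivAt_inv hx).mul_const w).hasDerivWithinAt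
  have h := lintegral_image_eq_lintegral_abs_deriv_mul (measurableSet_singleton (0 : ℝ)).compl
    hd hinj (fun y => ENNReal.ofReal |y|⁻¹ * g y)
  have hae : (volume : Measure ℝ).restrict {0}ᶜ = volume :=
    Measure.restrict_eq_self_of_ae_mem (Measure.ae_ne volume 0)
  rw [himg, hae] at h
  rw [h]
  refine lintegral_congr_ae ?_
  filter_upwards [Measure.ae_ne volume (0 : ℝ)] with x hx
  rw [← mul_assoc, ← ENNReal.ofReal_mul (abs_nonneg _), ← abs_inv, ← abs_inv, ← abs_mul]
  congr 2
  rw [abs_eq_abs]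
  right
  field_simp

/-- The change of variables `η = ξ⁻¹ w` for the invariant measure `dξ / |det A_ξ|`. -/
theorem lintegral_detA_inv_mul_comp {w : ℝ × ℝ} (hw : detA w ≠ 0) {Φ : ℝ × ℝ → ℝ≥0∞}
    (hΦ : Measurable Φ) :
    ∫⁻ ξ, ENNReal.ofReal |detA ξ|⁻¹ * Φ (dil (ξ.1⁻¹, ξ.2⁻¹) w) ∂mu2 =
      ∫⁻ η, ENNReal.ofReal |detA η|⁻¹ * Φ η ∂mu2 := by
  have hm := measurable_detA
  have hm' : Measurable fun ξ : ℝ × ℝ => dil (ξ.1⁻¹, ξ.2⁻¹) w :=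
    measurable_dil.comp (by fun_prop : Measurable fun ξ : ℝ × ℝ => ((ξ.1⁻¹, ξ.2⁻¹), w))
  have e (x y : ℝ) : ENNReal.ofReal |detA (x, y)|⁻¹ =
      ENNReal.ofReal |x|⁻¹ * ENNReal.ofReal |y|⁻¹ := by
    rw [detA, abs_mul, mul_inv, ENNReal.ofReal_mul (by positivity)]
  rw [mu2, lintegral_smul_measure, lintegral_smul_measure, Measure.volume_eq_prod,
    lintegral_prod _ (by fun_prop), lintegral_prod _ (by fun_prop)]
  congr 1
  simp_rw [e, mul_assoc, lintegral_const_mul' _ _ ENNReal.ofReal_ne_top, dil]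
  rw [lintegral_inv_mul_comp_div (left_ne_zero_of_mul hw)
    (fun t => ∫⁻ y, ENNReal.ofReal |y|⁻¹ * Φ (t, y⁻¹ * w.2))]
  congr 1; ext x; congr 1
  exact lintegral_inv_mul_comp_div (right_ne_zero_of_mul hw) (fun t => Φ (x, t))

/-- The two complex transforms into which the quaternion Stockwell transform decomposes. -/
noncomputable def cStockwell (s : ℝ) (c F : ℝ × ℝ → ℂ) (z : (ℝ × ℝ) × (ℝ × ℝ)) : ℂ :=
  |detA z.1| ^ (1 / 2 : ℝ) •
    ∫ x, chr (dot x (s * z.1.1, z.1.2)) * F x *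
      (starRingEnd ℂ) (c (dil z.1 (x - z.2))) ∂mu2

theorem stronglyMeasurable_cStockwell (s : ℝ) {c F : ℝ × ℝ → ℂ} (hc : StronglyMeasurable c)
    (hF : StronglyMeasurable F) : StronglyMeasurable (cStockwell s c F) := by
  have hd : Measurable fun z : (ℝ × ℝ) × (ℝ × ℝ) => |detA z.1| ^ (1 / 2 : ℝ) := by
    unfold detA; fun_prop
  have h1 : Continuous fun p : ((ℝ × ℝ) × (ℝ × ℝ)) × (ℝ × ℝ) =>
      chr (dot p.2 (s * p.1.1.1, p.1.1.2)) := continuous_chr.comp (continuous_dot.comp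
    (by fun_prop : Continuous fun p : ((ℝ × ℝ) × (ℝ × ℝ)) × (ℝ × ℝ) =>
      (p.2, (s * p.1.1.1, p.1.1.2))))
  have h2 : Measurable fun p : ((ℝ × ℝ) × (ℝ × ℝ)) × (ℝ × ℝ) => dil p.1.1 (p.2 - p.1.2) :=
    measurable_dil.comp (by fun_prop : Measurable fun p : ((ℝ × ℝ) × (ℝ × ℝ)) × (ℝ × ℝ) =>
      (p.1.1, p.2 - p.1.2))
  have h3 : StronglyMeasurable fun p : ((ℝ × ℝ) × (ℝ × ℝ)) × (ℝ × ℝ) =>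
      chr (dot p.2 (s * p.1.1.1, p.1.1.2)) * F p.2 *
        (starRingEnd ℂ) (c (dil p.1.1 (p.2 - p.1.2))) :=
    (h1.stronglyMeasurable.mul (hF.comp_measurable measurable_snd)).mul
      (Complex.continuous_conj.comp_stronglyMeasurable (hc.comp_measurable h2))
  exact hd.stronglyMeasurable.smul h3.integral_prod_right'

theorem cFourier_conj_comp_dil_neg {ξ : ℝ × ℝ} (hξ : detA ξ ≠ 0) (c : ℝ × ℝ → ℂ) (w : ℝ × ℝ) :
    cFourier (fun y => (starRingEnd ℂ) (c (dil ξ (-y)))) w =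
      |detA ξ|⁻¹ • (starRingEnd ℂ) (cFourier c (dil (ξ.1⁻¹, ξ.2⁻¹) w)) := by
  have h1 : ξ.1 ≠ 0 := left_ne_zero_of_mul hξ
  have h2 : ξ.2 ≠ 0 := right_ne_zero_of_mul hξ
  rw [cFourier, cFourier, ← integral_conj, ← integral_comp_dil hξ,
    ← integral_neg_eq_self (fun x => chr (dot x w) * _)]
  congr 1; ext x
  rw [map_mul, conj_chr, neg_neg]
  congr 2
  simp only [dot, dil, Prod.fst_neg, Prod.snd_neg]
  field_simp
  ring

/-- In `b`, the integral is the convolution of a modulation of `F` with `y ↦ conj (c (A_ξ (-y)))`,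
so Plancherel applies. -/
theorem lintegral_enorm_sq_cStockwell_right (s : ℝ) {c F : ℝ × ℝ → ℂ}
    (hc1 : MemLp c 1 mu2) (hc2 : MemLp c 2 mu2) (hF1 : MemLp F 1 mu2) (hF2 : MemLp F 2 mu2)
    {ξ : ℝ × ℝ} (hξ : detA ξ ≠ 0) :
    ∫⁻ b, ‖cStockwell s c F (ξ, b)‖ₑ ^ 2 ∂mu2 =
      ENNReal.ofReal |detA ξ|⁻¹ * ∫⁻ w, ‖cFourier F w‖ₑ ^ 2 *
        ‖cFourier c (dil (ξ.1⁻¹, ξ.2⁻¹) w - (s, 1))‖ₑ ^ 2 ∂mu2 := by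
  have h1 : ξ.1 ≠ 0 := left_ne_zero_of_mul hξ
  have h2 : ξ.2 ≠ 0 := right_ne_zero_of_mul hξ
  set m : ℝ × ℝ := (s * ξ.1, ξ.2) with hm
  have hH {p : ℝ≥0∞} (h : MemLp c p mu2) :
      MemLp (fun y => (starRingEnd ℂ) (c (dil ξ (-y)))) p mu2 :=
    ((memLp_comp_dil hξ h).comp_measurePreserving (Measure.measurePreserving_neg mu2)).star
  have hdet : 0 < |detA ξ| := abs_pos.2 hξ
  have P := lintegral_enorm_sq_conv (memLp_chr_mul hF1 m) (hH hc1) (memLp_chr_mul hF2 m) (hH hc2)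
  simp_rw [cFourier_chr_mul, cFourier_conj_comp_dil_neg hξ, enorm_smul, mul_pow] at P
  have e (b : ℝ × ℝ) : ‖cStockwell s c F (ξ, b)‖ₑ ^ 2 = ENNReal.ofReal |detA ξ| *
      ‖∫ x, chr (dot x m) * F x * (starRingEnd ℂ) (c (dil ξ (-(b - x)))) ∂mu2‖ₑ ^ 2 := by
    rw [cStockwell, enorm_smul, mul_pow, Real.enorm_eq_ofReal (by positivity),
      ← ENNReal.ofReal_pow (by positivity), ← Real.rpow_natCast, ← Real.rpow_mul hdet.le]
    simp only [neg_sub]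
    norm_num
    rfl
  -- The squared prefactor gives `|det A_ξ|`, the transform of the dilated window gives `|det
  -- A_ξ|⁻²`.
  have e3 : ENNReal.ofReal |detA ξ| * ‖|detA ξ|⁻¹‖ₑ ^ 2 = ENNReal.ofReal |detA ξ|⁻¹ := by
    rw [Real.enorm_eq_ofReal (by positivity), ← ENNReal.ofReal_pow (by positivity),
      ← ENNReal.ofReal_mul hdet.le]
    congr 1; field_simp
  simp_rw [e]
  rw [lintegral_const_mul' _ _ ENNReal.ofReal_ne_top, P, ← e3, mul_assoc,
    ← lintegral_const_mul' (‖|detA ξ|⁻¹‖ₑ ^ 2) _ (ENNReal.pow_ne_top enorm_ne_top)]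
  congr 1
  -- Translating by the modulation frequency `m` moves the shift from `F` to the window, where
  -- `A_ξ⁻¹ m = (s, 1)`.
  rw [← lintegral_add_right_eq_self (μ := mu2) (fun w => ‖|detA ξ|⁻¹‖ₑ ^ 2 *
    (‖cFourier F w‖ₑ ^ 2 * ‖cFourier c (dil (ξ.1⁻¹, ξ.2⁻¹) w - (s, 1))‖ₑ ^ 2)) m]
  congr 1; ext w
  have e2 : dil (ξ.1⁻¹, ξ.2⁻¹) (w + m) - (s, 1) = dil (ξ.1⁻¹, ξ.2⁻¹) w := by
    simp only [dil, hm, Prod.fst_add, Prod.snd_add]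
    ext <;> simp <;> field_simp <;> ring
  rw [e2, RCLike.enorm_conj]
  ring

/-- For `s = -1`, reflect `η₁` and use evenness: this is how both components acquire the same
admissibility constant. -/
theorem lintegral_shift_eq {c : ℝ × ℝ → ℂ} (he : ∀ u v, cFourier c (-u, v) = cFourier c (u, v))
    {s : ℝ} (hs : s = 1 ∨ s = -1) :
    ∫⁻ η, ENNReal.ofReal |detA η|⁻¹ * ‖cFourier c (η - (s, 1))‖ₑ ^ 2 ∂mu2 =
      ∫⁻ η, ENNReal.ofReal |detA η|⁻¹ * ‖cFourier c (η - (1, 1))‖ₑ ^ 2 ∂mu2 := by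
  rcases hs with rfl | rfl
  · rfl
  · have hd : detA (-1, 1) ≠ 0 := by simp [detA]
    have h := lintegral_comp_dil hd
      (fun η => ENNReal.ofReal |detA η|⁻¹ * ‖cFourier c (η - (-1, 1))‖ₑ ^ 2)
    have h1 : ENNReal.ofReal |detA (-1, 1)|⁻¹ = 1 := by simp [detA]
    rw [h1, one_mul] at h
    rw [← h]
    congr 1; ext η
    have e1 : |detA (dil (-1, 1) η)| = |detA η| := by simp [detA, dil, abs_mul]
    have e2 : dil (-1, 1) η - (-1, 1) = (-(η.1 - 1), η.2 - 1) := by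
      simp only [dil]; ext <;> simp; ring
    rw [e1, e2, he]
    rfl

/-- The orthogonality relation for the complex transforms. -/
theorem lintegral_enorm_sq_cStockwell {s : ℝ} (hs : s = 1 ∨ s = -1) {c F : ℝ × ℝ → ℂ}
    (hc1 : MemLp c 1 mu2) (hc2 : MemLp c 2 mu2) (hF1 : MemLp F 1 mu2) (hF2 : MemLp F 2 mu2)
    (he : ∀ u v, cFourier c (-u, v) = cFourier c (u, v)) :
    ∫⁻ ξ, ∫⁻ b, ‖cStockwell s c F (ξ, b)‖ₑ ^ 2 ∂mu2 ∂mu2 =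
      (∫⁻ η, ENNReal.ofReal |detA η|⁻¹ * ‖cFourier c (η - (1, 1))‖ₑ ^ 2 ∂mu2) *
        ∫⁻ x, ‖F x‖ₑ ^ 2 ∂mu2 := by
  have hcm : Measurable (cFourier c) := (continuous_cFourier hc1).measurable
  have hFm : Measurable (cFourier F) := (continuous_cFourier hF1).measurable
  have hdm := measurable_detA
  have hΦ : Measurable fun η : ℝ × ℝ => ‖cFourier c (η - (s, 1))‖ₑ ^ 2 := by fun_prop
  have hdil : Measurable fun p : (ℝ × ℝ) × (ℝ × ℝ) => dil (p.1.1⁻¹, p.1.2⁻¹) p.2 :=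
    measurable_dil.comp (by fun_prop :
      Measurable fun p : (ℝ × ℝ) × (ℝ × ℝ) => ((p.1.1⁻¹, p.1.2⁻¹), p.2))
  calc ∫⁻ ξ, ∫⁻ b, ‖cStockwell s c F (ξ, b)‖ₑ ^ 2 ∂mu2 ∂mu2
      = ∫⁻ ξ, ∫⁻ w, ‖cFourier F w‖ₑ ^ 2 * (ENNReal.ofReal |detA ξ|⁻¹ *
          ‖cFourier c (dil (ξ.1⁻¹, ξ.2⁻¹) w - (s, 1))‖ₑ ^ 2) ∂mu2 ∂mu2 := by
        refine lintegral_congr_ae ?_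
        filter_upwards [ae_detA_ne_zero] with ξ hξ
        rw [lintegral_enorm_sq_cStockwell_right s hc1 hc2 hF1 hF2 hξ,
          ← lintegral_const_mul' _ _ ENNReal.ofReal_ne_top]
        congr 1; ext w; ring
    _ = ∫⁻ w, ∫⁻ ξ, ‖cFourier F w‖ₑ ^ 2 * (ENNReal.ofReal |detA ξ|⁻¹ *
          ‖cFourier c (dil (ξ.1⁻¹, ξ.2⁻¹) w - (s, 1))‖ₑ ^ 2) ∂mu2 ∂mu2 := by
        refine lintegral_lintegral_swap (Measurable.aemeasurable ?_)
        unfold Function.uncurry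
        fun_prop
    _ = ∫⁻ w, ‖cFourier F w‖ₑ ^ 2 *
          ∫⁻ η, ENNReal.ofReal |detA η|⁻¹ * ‖cFourier c (η - (1, 1))‖ₑ ^ 2 ∂mu2 ∂mu2 := by
        refine lintegral_congr_ae ?_
        -- When both coordinates of `w` are nonzero, the inner integral no longer depends on `w`.
        filter_upwards [ae_detA_ne_zero] with w hw
        rw [lintegral_const_mul' _ _ (ENNReal.pow_ne_top enorm_ne_top),
          lintegral_detA_inv_mul_comp hw hΦ, lintegral_shift_eq he hs]
    _ = _ := by
        rw [lintegral_mul_const _ (by fun_prop), lintegral_enorm_sq_cFourier hF1 hF2, mul_comm]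

/-! ### The quaternion Stockwell transform: measurability, pointwise bound, decomposition. -/

theorem stronglyMeasurable_stockwell {φ f : ℝ × ℝ → ℍ[ℝ]} (hφ : StronglyMeasurable φ)
    (hf : StronglyMeasurable f) : StronglyMeasurable (stockwell φ f) := by
  have hd : Measurable fun z : (ℝ × ℝ) × (ℝ × ℝ) => |detA z.1| ^ (1 / 2 : ℝ) := by
    unfold detA; fun_prop
  have h1 : Continuous fun p : ((ℝ × ℝ) × (ℝ × ℝ)) × (ℝ × ℝ) =>
      expI (-(p.2.1 * p.1.1.1)) := continuous_expI.comp (by fun_prop)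
  have h1' : Continuous fun p : ((ℝ × ℝ) × (ℝ × ℝ)) × (ℝ × ℝ) =>
      expJ (-(p.2.2 * p.1.1.2)) := continuous_expJ.comp (by fun_prop)
  have h2 : Measurable fun p : ((ℝ × ℝ) × (ℝ × ℝ)) × (ℝ × ℝ) => dil p.1.1 (p.2 - p.1.2) :=
    measurable_dil.comp (by fun_prop : Measurable fun p : ((ℝ × ℝ) × (ℝ × ℝ)) × (ℝ × ℝ) =>
      (p.1.1, p.2 - p.1.2))
  have h3 : StronglyMeasurable fun p : ((ℝ × ℝ) × (ℝ × ℝ)) × (ℝ × ℝ) =>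
      expI (-(p.2.1 * p.1.1.1)) * f p.2 * expJ (-(p.2.2 * p.1.1.2)) *
        star (φ (dil p.1.1 (p.2 - p.1.2))) :=
    ((h1.stronglyMeasurable.mul (hf.comp_measurable measurable_snd)).mul
      h1'.stronglyMeasurable).mul
      (continuous_star.comp_stronglyMeasurable (hφ.comp_measurable h2))
  exact hd.stronglyMeasurable.smul h3.integral_prod_right'

theorem stockwell_of_detA_eq_zero (φ f : ℝ × ℝ → ℍ[ℝ]) {z : (ℝ × ℝ) × (ℝ × ℝ)}
    (hz : detA z.1 = 0) : stockwell φ f z = 0 := by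
  rw [stockwell, hz, abs_zero, Real.zero_rpow (by norm_num), zero_smul]

theorem quasiMeasurePreserving_dil_sub {ξ : ℝ × ℝ} (hξ : detA ξ ≠ 0) (b : ℝ × ℝ) :
    Measure.QuasiMeasurePreserving (fun x => dil ξ (x - b)) mu2 mu2 :=
  (quasiMeasurePreserving_dil hξ).comp
    (measurePreserving_sub_right mu2 b).quasiMeasurePreserving

/-- Equality holds at every `z`: null sets pull back to null sets under an invertible dilation, and
at `det A_ξ = 0` the prefactor vanishes. -/
theorem stockwell_congr {φ φ' f f' : ℝ × ℝ → ℍ[ℝ]} (hφ : φ =ᵐ[mu2] φ') (hf : f =ᵐ[mu2] f') :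
    stockwell φ f = stockwell φ' f' := by
  ext1 z
  by_cases hz : detA z.1 = 0
  · rw [stockwell_of_detA_eq_zero _ _ hz, stockwell_of_detA_eq_zero _ _ hz]
  · rw [stockwell, stockwell]
    congr 1
    refine integral_congr_ae ?_
    filter_upwards [hf, (quasiMeasurePreserving_dil_sub hz z.2).ae_eq_comp hφ] with x h1 h2
    rw [h1]
    exact congrArg (fun q => _ * star q) h2

theorem qNorm_congr {X : Type*} [MeasurableSpace X] {p : ℝ} {μ : Measure X} {F G : X → ℍ[ℝ]}
    (h : F =ᵐ[μ] G) : qNorm p μ F = qNorm p μ G := by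
  rw [qNorm, qNorm, integral_congr_ae]
  filter_upwards [h] with x hx
  rw [hx]

theorem memLp_star_comp_dil_sub {p : ℝ≥0∞} {φ : ℝ × ℝ → ℍ[ℝ]} (hφ : MemLp φ p mu2)
    {ξ : ℝ × ℝ} (hξ : detA ξ ≠ 0) (b : ℝ × ℝ) :
    MemLp (fun x => star (φ (dil ξ (x - b)))) p mu2 := by
  have h := (memLp_comp_dil hξ hφ).comp_measurePreserving (measurePreserving_sub_right mu2 b)
  exact h.of_le (continuous_star.comp_aestronglyMeasurable h.1)
    (.of_forall fun x => (norm_star _).le)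

theorem integrable_stockwell_integrand {φ f : ℝ × ℝ → ℍ[ℝ]} (hφ : MemLp φ 2 mu2)
    (hf : MemLp f 2 mu2) {ξ : ℝ × ℝ} (hξ : detA ξ ≠ 0) (b : ℝ × ℝ) :
    Integrable (fun x => expI (-(x.1 * ξ.1)) * f x * expJ (-(x.2 * ξ.2)) *
      star (φ (dil ξ (x - b)))) mu2 :=
  (memLp_expI_mul_expJ hf ξ).integrable_mul (memLp_star_comp_dil_sub hφ hξ b)

/-- Cauchy–Schwarz; the prefactor `|det A_ξ|^(1/2)` cancels the `|det A_ξ|^(-1/2)` in the norm of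
the dilated window. -/
theorem norm_stockwell_le {φ f : ℝ × ℝ → ℍ[ℝ]} (hφ : MemLp φ 2 mu2) (hf : MemLp f 2 mu2)
    (z : (ℝ × ℝ) × (ℝ × ℝ)) : ‖stockwell φ f z‖ ≤ qNorm 2 mu2 f * qNorm 2 mu2 φ := by
  by_cases hz : detA z.1 = 0
  · rw [stockwell_of_detA_eq_zero _ _ hz, norm_zero]
    unfold qNorm
    positivity
  have hd : 0 < |detA z.1| := abs_pos.2 hz
  have h := (norm_integral_le_integral_norm _).trans_eq (integral_congr_ae (.of_forall fun x =>
      norm_mul _ _)) |>.trans (norm_integral_mul_le (memLp_expI_mul_expJ hf z.1)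
      (memLp_star_comp_dil_sub hφ hz z.2))
  simp_rw [norm_expI_mul_expJ, norm_star] at h
  rw [integral_sub_right_eq_self (fun x => ‖φ (dil z.1 x)‖ ^ (2 : ℝ)) z.2,
    integral_comp_dil hz (fun x => ‖φ x‖ ^ (2 : ℝ)), smul_eq_mul,
    Real.mul_rpow (by positivity) (by positivity), Real.inv_rpow hd.le] at h
  rw [stockwell, norm_smul, Real.norm_of_nonneg (by positivity)]
  refine (mul_le_mul_of_nonneg_left h (by positivity)).trans_eq ?_
  rw [qNorm, qNorm]
  have : |detA z.1| ^ (1 / 2 : ℝ) ≠ 0 := by positivity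
  field_simp

theorem cpart_stockwell {s : ℝ} (hs : s = 1 ∨ s = -1) {c : ℝ × ℝ → ℂ} {f : ℝ × ℝ → ℍ[ℝ]}
    (hc : MemLp (fun x => ofCj (c x)) 2 mu2) (hf : MemLp f 2 mu2) {z : (ℝ × ℝ) × (ℝ × ℝ)}
    (hz : detA z.1 ≠ 0) :
    cpart s (stockwell (fun x => ofCj (c x)) f z) =
      cStockwell s c (fun x => cpart s (f x)) z := by
  rw [stockwell, cStockwell, map_smul, ← ContinuousLinearMap.integral_comp_comm _
    (integrable_stockwell_integrand hc hf hz z.2)]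
  congr 2; ext1 x
  rw [star_ofCj, cpart_mul_ofCj, cpart_expI_mul hs]
  congr 3; simp only [dot]; ring

theorem enorm_sq_eq_cpart (q : ℍ[ℝ]) :
    ‖q‖ₑ ^ 2 = 2 * (‖cpart 1 q‖ₑ ^ 2 + ‖cpart (-1) q‖ₑ ^ 2) := by
  simp_rw [← ofReal_norm, ← ENNReal.ofReal_pow (norm_nonneg _)]
  rw [norm_sq_eq_cpart, ENNReal.ofReal_mul (by norm_num),
    ENNReal.ofReal_add (by positivity) (by positivity), ENNReal.ofReal_ofNat]

theorem continuous_ofCj : Continuous ofCj := by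
  have : ofCj = fun w => w.re • (1 : ℍ[ℝ]) + w.im • qj := by
    ext w <;> simp
  rw [this]; fun_prop

theorem memLp_ofCj {p : ℝ≥0∞} {c : ℝ × ℝ → ℂ} (hc : MemLp c p mu2) :
    MemLp (fun x => ofCj (c x)) p mu2 :=
  hc.of_le (continuous_ofCj.comp_aestronglyMeasurable hc.1)
    (.of_forall fun _ => (norm_ofCj _).le)

/-! ### Orthogonality relation and the `L²` bound. -/

section Orthogonality

variable {c : ℝ × ℝ → ℂ} {f : ℝ × ℝ → ℍ[ℝ]}

theorem lintegral_enorm_sq_stockwell_of_memLp_one (hcm : StronglyMeasurable c)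
    (hc1 : MemLp c 1 mu2) (hc2 : MemLp c 2 mu2)
    (he : ∀ u v, cFourier c (-u, v) = cFourier c (u, v))
    (hfm : StronglyMeasurable f) (hf1 : MemLp f 1 mu2) (hf2 : MemLp f 2 mu2) :
    ∫⁻ z, ‖stockwell (fun x => ofCj (c x)) f z‖ₑ ^ 2 ∂mu4 =
      (∫⁻ η, ENNReal.ofReal |detA η|⁻¹ * ‖cFourier c (η - (1, 1))‖ₑ ^ 2 ∂mu2) *
        ∫⁻ x, ‖f x‖ₑ ^ 2 ∂mu2 := by
  have hF (s : ℝ) : StronglyMeasurable fun x => cpart s (f x) :=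
    (cpart s).continuous.comp_stronglyMeasurable hfm
  have hS (s : ℝ) : Measurable fun z => ‖cStockwell s c (fun x => cpart s (f x)) z‖ₑ ^ 2 :=
    (stronglyMeasurable_cStockwell s hcm (hF s)).measurable.enorm.pow_const 2
  have hP {p : ℝ≥0∞} (hp : MemLp f p mu2) (s : ℝ) : MemLp (fun x => cpart s (f x)) p mu2 :=
    (cpart s).comp_memLp' hp
  have hdet : ∀ᵐ z ∂mu2.prod mu2, detA z.1 ≠ 0 :=
    Measure.quasiMeasurePreserving_fst.ae ae_detA_ne_zero
  have h1 : ∀ᵐ z ∂mu2.prod mu2, ‖stockwell (fun x => ofCj (c x)) f z‖ₑ ^ 2 =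
      2 * (‖cStockwell 1 c (fun x => cpart 1 (f x)) z‖ₑ ^ 2 +
        ‖cStockwell (-1) c (fun x => cpart (-1) (f x)) z‖ₑ ^ 2) := by
    filter_upwards [hdet] with z hz
    rw [enorm_sq_eq_cpart, cpart_stockwell (.inl rfl) (memLp_ofCj hc2) hf2 hz,
      cpart_stockwell (.inr rfl) (memLp_ofCj hc2) hf2 hz]
  rw [mu4_eq_prod, lintegral_congr_ae h1, lintegral_const_mul' _ _ ENNReal.ofNat_ne_top,
    lintegral_add_left (hS 1), lintegral_prod _ (hS 1).aemeasurable,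
    lintegral_prod _ (hS (-1)).aemeasurable,
    lintegral_enorm_sq_cStockwell (.inl rfl) hc1 hc2 (hP hf1 1) (hP hf2 1) he,
    lintegral_enorm_sq_cStockwell (.inr rfl) hc1 hc2 (hP hf1 (-1)) (hP hf2 (-1)) he,
    ← mul_add, ← lintegral_add_left ((hF 1).measurable.enorm.pow_const 2), mul_left_comm]
  congr 1
  rw [← lintegral_const_mul' _ _ ENNReal.ofNat_ne_top]
  simp_rw [enorm_sq_eq_cpart (f _)]

/-- Truncate `f` to balls, which puts it in `L¹ ∩ L²`. The transforms converge pointwise by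
dominated convergence, and Fatou's lemma yields the inequality, which suffices here. -/
theorem lintegral_enorm_sq_stockwell_le (hcm : StronglyMeasurable c)
    (hc1 : MemLp c 1 mu2) (hc2 : MemLp c 2 mu2)
    (he : ∀ u v, cFourier c (-u, v) = cFourier c (u, v))
    (hfm : StronglyMeasurable f) (hf2 : MemLp f 2 mu2) :
    ∫⁻ z, ‖stockwell (fun x => ofCj (c x)) f z‖ₑ ^ 2 ∂mu4 ≤
      (∫⁻ η, ENNReal.ofReal |detA η|⁻¹ * ‖cFourier c (η - (1, 1))‖ₑ ^ 2 ∂mu2) *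
        ∫⁻ x, ‖f x‖ₑ ^ 2 ∂mu2 := by
  set φ : ℝ × ℝ → ℍ[ℝ] := fun x => ofCj (c x)
  set C := ∫⁻ η, ENNReal.ofReal |detA η|⁻¹ * ‖cFourier c (η - (1, 1))‖ₑ ^ 2 ∂mu2
  have hφ2 : MemLp φ 2 mu2 := memLp_ofCj hc2
  have hφm : StronglyMeasurable φ := continuous_ofCj.comp_stronglyMeasurable hcm
  set B : ℕ → Set (ℝ × ℝ) := fun n => Metric.closedBall 0 n
  have hBm n : MeasurableSet (B n) := Metric.isClosed_closedBall.measurableSet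
  have hBf n : mu2 (B n) ≠ ∞ := (isCompact_closedBall (0 : ℝ × ℝ) n).measure_lt_top.ne
  set F : ℕ → ℝ × ℝ → ℍ[ℝ] := fun n => (B n).indicator f
  have hFm n : StronglyMeasurable (F n) := hfm.indicator (hBm n)
  have hF2 n : MemLp (F n) 2 mu2 := hf2.indicator (hBm n)
  have hF1 n : MemLp (F n) 1 mu2 := by
    rw [memLp_indicator_iff_restrict (hBm n)]
    have : IsFiniteMeasure (mu2.restrict (B n)) := ⟨by
      rw [Measure.restrict_apply_univ]; exact (hBf n).lt_top⟩
    exact (hf2.restrict (B n)).mono_exponent (by norm_num)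
  have hle n x : ‖F n x‖ ≤ ‖f x‖ := norm_indicator_le_norm_self _ _
  have hlim x : ∀ᶠ n in atTop, F n x = f x := by
    obtain ⟨N, hN⟩ := exists_nat_ge ‖x‖
    filter_upwards [eventually_ge_atTop N] with n hn
    exact Set.indicator_of_mem (by
      simpa [B] using hN.trans (Nat.cast_le.2 hn)) _
  have hS z : Tendsto (fun n => stockwell φ (F n) z) atTop (nhds (stockwell φ f z)) := by
    by_cases hz : detA z.1 = 0
    · simp_rw [stockwell_of_detA_eq_zero φ _ hz]; exact tendsto_const_nhds
    refine Tendsto.const_smul (tendsto_integral_of_dominated_convergence _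
      (fun n => (integrable_stockwell_integrand hφ2 (hF2 n) hz z.2).aestronglyMeasurable)
      (integrable_stockwell_integrand hφ2 hf2 hz z.2).norm
      (fun n => .of_forall fun x => ?_) (.of_forall fun x => ?_)) _
    · rw [norm_mul _ (star _), norm_mul _ (star _), norm_expI_mul_expJ, norm_expI_mul_expJ]
      exact mul_le_mul_of_nonneg_right (hle n x) (norm_nonneg _)
    · refine tendsto_const_nhds.congr' ?_
      filter_upwards [hlim x] with n hn
      rw [hn]
  calc ∫⁻ z, ‖stockwell φ f z‖ₑ ^ 2 ∂mu4
      = ∫⁻ z, liminf (fun n => ‖stockwell φ (F n) z‖ₑ ^ 2) atTop ∂mu4 := by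
        congr 1; ext1 z
        exact (((ENNReal.continuous_pow 2).tendsto _).comp (hS z).enorm).liminf_eq.symm
    _ ≤ liminf (fun n => ∫⁻ z, ‖stockwell φ (F n) z‖ₑ ^ 2 ∂mu4) atTop :=
        lintegral_liminf_le fun n =>
          (stronglyMeasurable_stockwell hφm (hFm n)).enorm.pow_const 2
    _ ≤ C * ∫⁻ x, ‖f x‖ₑ ^ 2 ∂mu2 := by
        refine liminf_le_of_le (by isBoundedDefault) fun b hb => ?_
        obtain ⟨n, hn⟩ := hb.exists
        refine hn.trans ?_
        rw [lintegral_enorm_sq_stockwell_of_memLp_one hcm hc1 hc2 he (hFm n) (hF1 n) (hF2 n)]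
        gcongr with x
        exact enorm_le_iff_norm_le.2 (hle n x)

end Orthogonality

theorem lintegral_eq_admConst {φ : ℝ × ℝ → ℍ[ℝ]} {c : ℝ × ℝ → ℂ} (hφ : IsAdmissibleWindow φ)
    (hc : φ =ᵐ[mu2] fun x => ofCj (c x)) (he : ∀ u v, cFourier c (-u, v) = cFourier c (u, v)) :
    ∫⁻ η, ENNReal.ofReal |detA η|⁻¹ * ‖cFourier c (η - (1, 1))‖ₑ ^ 2 ∂mu2 =
      ENNReal.ofReal (admConst φ) := by
  rw [admConst, ofReal_integral_eq_lintegral_ofReal hφ.integrable (.of_forall fun ξ => by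
    unfold admIntegrand; positivity)]
  congr 1; ext1 ξ
  rw [admIntegrand, norm_sq_qFourier_star hφ.memL1 hc he, neg_sub, div_eq_inv_mul,
    ENNReal.ofReal_mul (by positivity), ENNReal.ofReal_pow (norm_nonneg _), ofReal_norm]

theorem qNorm_two_sq {X : Type*} [MeasurableSpace X] {μ : Measure X} {F : X → ℍ[ℝ]}
    (hF : MemLp F 2 μ) : ENNReal.ofReal (qNorm 2 μ F ^ 2) = ∫⁻ x, ‖F x‖ₑ ^ 2 ∂μ := by
  rw [qNorm, ← Real.rpow_natCast, ← Real.rpow_mul (by positivity)]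
  norm_num
  rw [ofReal_integral_eq_lintegral_ofReal ((memLp_two_iff_integrable_sq_norm hF.1).1 hF)
    (.of_forall fun x => by positivity)]
  simp_rw [ENNReal.ofReal_pow (norm_nonneg _), ofReal_norm]

/-- For a window satisfying the commutation hypothesis, the Stockwell transform is bounded from
`L²` to `L²` with norm at most `√C_φ`. -/
theorem memLp_two_stockwell {φ f : ℝ × ℝ → ℍ[ℝ]} (hφ : IsAdmissibleWindow φ)
    (hF : FourierCommutes φ) (hf : MemLp f 2 mu2) :
    MemLp (stockwell φ f) 2 mu4 ∧
      qNorm 2 mu4 (stockwell φ f) ≤ Real.sqrt (admConst φ) * qNorm 2 mu2 f := by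
  obtain ⟨c, hcm, hc1, hc2, hcφ, he⟩ := exists_complex_window hφ.memL1 hφ.memL2 hF
  have hfm := hf.1.stronglyMeasurable_mk
  have hf' : MemLp (hf.1.mk f) 2 mu2 := (memLp_congr_ae hf.1.ae_eq_mk).1 hf
  have hS := stronglyMeasurable_stockwell (continuous_ofCj.comp_stronglyMeasurable hcm) hfm
  have hle := lintegral_enorm_sq_stockwell_le hcm hc1 hc2 he hfm hf'
  have hn : (0 : ℝ) ≤ qNorm 2 mu2 (hf.1.mk f) := by unfold qNorm; positivity
  rw [lintegral_eq_admConst hφ hcφ he, ← qNorm_two_sq hf', ← ENNReal.ofReal_mul hφ.pos.le] at hle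
  rw [stockwell_congr hcφ hf.1.ae_eq_mk, qNorm_congr hf.1.ae_eq_mk]
  have hmem : MemLp (stockwell (fun x => ofCj (c x)) (hf.1.mk f)) 2 mu4 := by
    refine ⟨hS.aestronglyMeasurable, ?_⟩
    rw [eLpNorm_lt_top_iff_lintegral_rpow_enorm_lt_top (by norm_num) (by norm_num)]
    simpa using hle.trans_lt ENNReal.ofReal_lt_top
  refine ⟨hmem, ?_⟩
  rw [← qNorm_two_sq hmem, ENNReal.ofReal_le_ofReal_iff
    (mul_nonneg hφ.pos.le (sq_nonneg _))] at hle
  refine le_of_sq_le_sq ?_ (by positivity)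
  rwa [mul_pow, Real.sq_sqrt hφ.pos.le]

/-! ### Interpolation between `p = 1` and the uniform bound. -/

/-- The Lieb inequality for the two-dimensional quaternion Stockwell transform. -/
theorem lieb_inequality (φ ψ : ℝ × ℝ → ℍ[ℝ])
    (hφ : IsAdmissibleWindow φ) (hψ : IsAdmissibleWindow ψ)
    (hφF : FourierCommutes φ) (hψF : FourierCommutes ψ)
    (p : ℝ) (hp : 1 ≤ p) (f g : ℝ × ℝ → ℍ[ℝ])
    (hf : MemLp f 2 mu2) (hg : MemLp g 2 mu2) :
    MemLp (fun z => stockwell φ f z * stockwell ψ g z)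
        (ENNReal.ofReal p) mu4 ∧
      qNorm p mu4
          (fun z => stockwell φ f z * stockwell ψ g z) ≤
        Real.sqrt (admConst φ * admConst ψ) ^ (1 / p) *
          qNorm 2 mu2 f * qNorm 2 mu2 g *
          (qNorm 2 mu2 φ * qNorm 2 mu2 ψ) ^
            (1 - 1 / p) := by
  have hp0 : 0 < p := by linarith
  obtain ⟨hA, hA'⟩ := memLp_two_stockwell hφ hφF hf
  obtain ⟨hB, hB'⟩ := memLp_two_stockwell hψ hψF hg
  have hnn (h : ℝ × ℝ → ℍ[ℝ]) : 0 ≤ qNorm 2 mu2 h := by unfold qNorm; positivity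
  have hnn4 (h : (ℝ × ℝ) × (ℝ × ℝ) → ℍ[ℝ]) : 0 ≤ qNorm 2 mu4 h := by unfold qNorm; positivity
  set A := stockwell φ f
  set B := stockwell ψ g
  set N := qNorm 2 mu2 f * qNorm 2 mu2 g with hN
  set W := qNorm 2 mu2 φ * qNorm 2 mu2 ψ with hW
  set C := Real.sqrt (admConst φ * admConst ψ) with hC
  have hN0 : 0 ≤ N := mul_nonneg (hnn f) (hnn g)
  have hW0 : 0 ≤ W := mul_nonneg (hnn φ) (hnn ψ)
  have hC0 : 0 ≤ C := Real.sqrt_nonneg _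
  have hI : Integrable (fun z => A z * B z) mu4 := hA.integrable_mul hB
  have hsup z : ‖A z * B z‖ ≤ N * W := by
    rw [norm_mul]
    refine (mul_le_mul (norm_stockwell_le hφ.memL2 hf z) (norm_stockwell_le hψ.memL2 hg z)
      (norm_nonneg _) (mul_nonneg (hnn f) (hnn φ))).trans_eq ?_
    rw [hN, hW]; ring
  have hL1 : ∫ z, ‖A z * B z‖ ∂mu4 ≤ C * N := by
    simp_rw [norm_mul]
    refine (norm_integral_mul_le hA hB).trans ((mul_le_mul hA' hB' (hnn4 B)
      (mul_nonneg (Real.sqrt_nonneg _) (hnn f))).trans_eq ?_)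
    rw [hC, hN, Real.sqrt_mul hφ.pos.le]; ring
  have hpt z : ‖A z * B z‖ ^ p ≤ (N * W) ^ (p - 1) * ‖A z * B z‖ := by
    have h0 := norm_nonneg (A z * B z)
    calc ‖A z * B z‖ ^ p = ‖A z * B z‖ ^ (p - 1) * ‖A z * B z‖ := by
          conv_rhs => rw [← Real.rpow_one ‖A z * B z‖, ← Real.rpow_mul h0, one_mul]
          -- The norm may vanish, so adding exponents relies on `p - 1 ≥ 0` and not on a positive
          -- base.
          rw [← Real.rpow_add_of_nonneg h0 (by linarith) zero_le_one, sub_add_cancel]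
      _ ≤ _ := mul_le_mul_of_nonneg_right
          (Real.rpow_le_rpow h0 (hsup z) (by linarith)) h0
  have hIp : Integrable (fun z => ‖A z * B z‖ ^ p) mu4 := by
    refine (hI.norm.const_mul ((N * W) ^ (p - 1))).mono'
      (hI.norm.aemeasurable.pow_const p).aestronglyMeasurable (.of_forall fun z => ?_)
    rw [Real.norm_of_nonneg (by positivity)]
    exact hpt z
  refine ⟨?_, ?_⟩
  · rw [← integrable_norm_rpow_iff hI.aestronglyMeasurable (by simpa using hp0)
      ENNReal.ofReal_ne_top, ENNReal.toReal_ofReal hp0.le]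
    exact hIp
  -- The factor `N^(p-1)` from the uniform bound joins the `N` from the `L¹` bound, so the `p`-th
  -- root leaves exactly `N` and `W^(1 - 1/p)`.
  · have hint : ∫ z, ‖A z * B z‖ ^ p ∂mu4 ≤ C * N ^ p * W ^ (p - 1) := by
      refine (integral_mono hIp (hI.norm.const_mul _) hpt).trans ?_
      rw [integral_const_mul]
      refine (mul_le_mul_of_nonneg_left hL1 (by positivity)).trans_eq ?_
      have : N ^ p = N ^ (p - 1) * N := by
        conv_rhs => rw [← Real.rpow_one N, ← Real.rpow_mul hN0, one_mul]
        rw [← Real.rpow_add_of_nonneg hN0 (by linarith) zero_le_one, sub_add_cancel]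
      rw [this, Real.mul_rpow hN0 hW0]; ring
    rw [qNorm]
    refine (Real.rpow_le_rpow (by positivity) hint (by positivity)).trans_eq ?_
    rw [Real.mul_rpow (by positivity) (by positivity), Real.mul_rpow hC0 (by positivity),
      ← Real.rpow_mul hN0, ← Real.rpow_mul hW0, mul_one_div_cancel hp0.ne', Real.rpow_one, hN,
      mul_assoc (C ^ (1 / p)) (qNorm 2 mu2 f), sub_mul, mul_one_div_cancel hp0.ne', one_mul]

end QStockwell

theorem mainTheorem4 (φ ψ : ℝ × ℝ → ℍ[ℝ])
    (hφ : QStockwell.IsAdmissibleWindow φ) (hψ : QStockwell.IsAdmissibleWindow ψ)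
    (hφF : QStockwell.FourierCommutes φ) (hψF : QStockwell.FourierCommutes ψ)
    (p : ℝ) (hp : 1 ≤ p) (f g : ℝ × ℝ → ℍ[ℝ])
    (hf : MemLp f 2 QStockwell.mu2) (hg : MemLp g 2 QStockwell.mu2) :
    MemLp (fun z => QStockwell.stockwell φ f z * QStockwell.stockwell ψ g z)
        (ENNReal.ofReal p) QStockwell.mu4 ∧
      QStockwell.qNorm p QStockwell.mu4
          (fun z => QStockwell.stockwell φ f z * QStockwell.stockwell ψ g z) ≤
        Real.sqrt (QStockwell.admConst φ * QStockwell.admConst ψ) ^ (1 / p) *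
          QStockwell.qNorm 2 QStockwell.mu2 f * QStockwell.qNorm 2 QStockwell.mu2 g *
          (QStockwell.qNorm 2 QStockwell.mu2 φ * QStockwell.qNorm 2 QStockwell.mu2 ψ) ^
            (1 - 1 / p) :=
  QStockwell.lieb_inequality φ ψ hφ hψ hφF hψF p hp f g hf hg
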